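/- Let $n$ be a natural number, let $D^n=\{z\in\mathbb{C}^n : |z_i|<1 \text{ for all } i\}$ be the open unit polydisc and $B^n=\{z\in\mathbb{C}^n : \|z\|<1\}$ the open Euclidean unit ball in $\mathbb{C}^n$, and let $\partial D^n$, $\partial B^n$ be their topological boundaries. For a compact set $L\subseteq\mathbb{C}^n$, let $C(L)$ be the space of continuous functions $L\to\mathbb{C}$ with the topology of uniform convergence. A function $f\in C(L)$ is called holomorphically extendable at a point $\zeta\in L$ if there are an open neighborhood $U\subseteq\mathbb{C}^n$ of $\zeta$ and a holomorphic function $F:U\to\mathbb{C}$ such that $F=f$ on $U\cap L$. **Theorem.** 1. For every point $\zeta\in\partial D^n$, the set of functions in $C(\partial D^n)$ that are not holomorphically extendable at $\zeta$ is a dense $G_\delta$ subset of $C(\partial D^n)$. The set of functions in $C(\partial D^n)$ that are not holomorphically extendable at any point of $\partial D^n$ is also a dense $G_\delta$ subset of $C(\partial D^n)$. 2. For every point $\zeta\in\partial B^n$, the set of functions in $C(\partial B^n)$ that are not holomorphically extendable at $\zeta$ is a dense $G_\delta$ subset of $C(\partial B^n)$. The set of functions in $C(\partial B^n)$ that are not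 holomorphically extendable at any point of $\partial B^n$ is also a dense $G_\delta$ subset of $C(\partial B^n)$. -/

import Mathlib

/-- The open unit polydisc `Dⁿ` in `ℂⁿ` (the `n`-fold product of the open unit disc). -/
def unitPolydisc (n : ℕ) : Set (EuclideanSpace ℂ (Fin n)) :=
  {z | ∀ i, ‖z i‖ < 1}

/-- The open Euclidean unit ball `Bⁿ` in `ℂⁿ`. -/
def unitBall (n : ℕ) : Set (EuclideanSpace ℂ (Fin n)) :=
  Metric.ball 0 1

/-- A continuous function `f : L → ℂ` on a subset `L` of `ℂⁿ` is holomorphically extendable at the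
point `ζ` of `L` if there are an open neighbourhood `U` of `ζ` in `ℂⁿ` and a function `F`
holomorphic on `U` (only the values of `F` on `U` matter) such that `F = f` on `U ∩ L`. -/
def HolomorphicallyExtendableAt {n : ℕ} {L : Set (EuclideanSpace ℂ (Fin n))}
    (f : C(L, ℂ)) (ζ : L) : Prop :=
  ∃ U : Set (EuclideanSpace ℂ (Fin n)), IsOpen U ∧ (ζ : EuclideanSpace ℂ (Fin n)) ∈ U ∧
    ∃ F : EuclideanSpace ℂ (Fin n) → ℂ, DifferentiableOn ℂ F U ∧
      ∀ z : L, (z : EuclideanSpace ℂ (Fin n)) ∈ U → F z = f z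

/-- The functions in `C(L)` that are not holomorphically extendable at the given point `ζ`. -/
def nonExtendableAt {n : ℕ} (L : Set (EuclideanSpace ℂ (Fin n))) (ζ : L) : Set C(L, ℂ) :=
  {f | ¬ HolomorphicallyExtendableAt f ζ}

/-- The functions in `C(L)` that are not holomorphically extendable at any point of `L`. -/
def nowhereExtendable {n : ℕ} (L : Set (EuclideanSpace ℂ (Fin n))) : Set C(L, ℂ) :=
  {f | ∀ ζ : L, ¬ HolomorphicallyExtendableAt f ζ}

open Filter Topology Metric

/-! Extendability at `ζ` is witnessed by a bounded pair (extension, derivative) with a quadratic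
Taylor remainder. With radius `1/(k+1)` and bound `m` fixed, such pairs satisfy pointwise closed
conditions in a compact product of closed balls, so projecting them away gives a closed set in
`C(L)`. The extendable functions are the countable union of these sets, whence the Gδ part. For
density, the extendable functions form a linear subspace, proper when `ζ` is not isolated in `L`,
hence with empty interior. Baire over a countable dense subset of `L` handles all points at once.
The two frontiers have no isolated points because they are invariant under rotation by the circle.
-/

/-- A holomorphic function of one variable mapping a disc of radius `2` to a bounded set has a
quadratic Taylor remainder. -/
lemma norm_sub_sub_mul_deriv_le {g : ℂ → ℂ} {M : ℝ} (hg : DifferentiableOn ℂ g (ball 0 2))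
    (hM : ∀ t ∈ ball (0 : ℂ) 2, ‖g t‖ ≤ M) {t : ℂ} (ht : t ∈ ball (0 : ℂ) 2) :
    ‖g t - g 0 - t * deriv g 0‖ ≤ M * ‖t‖ ^ 2 ∧ ‖deriv g 0‖ ≤ M := by
  have h0 : (0 : ℂ) ∈ ball (0 : ℂ) 2 := by simp
  have hmaps : Set.MapsTo g (ball 0 2) (closedBall (g 0) (2 * M)) := fun s hs => by
    rw [mem_closedBall_iff_norm]
    linarith [norm_sub_le (g s) (g 0), hM s hs, hM 0 h0]
  have hb : ∀ s ∈ ball (0 : ℂ) 2, ‖dslope g 0 s‖ ≤ 2 * M / 2 := fun s hs =>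
    Complex.norm_dslope_le_div_of_mapsTo_ball hg hmaps hs
  have hd : DifferentiableOn ℂ (dslope g 0) (ball 0 2) :=
    (Complex.differentiableOn_dslope (ball_mem_nhds 0 two_pos)).2 hg
  have hmaps' : Set.MapsTo (dslope g 0) (ball 0 2) (closedBall (dslope g 0 0) (2 * M)) :=
    fun s hs => by
      rw [mem_closedBall_iff_norm]
      linarith [norm_sub_le (dslope g 0 s) (dslope g 0 0), hb s hs, hb 0 h0]
  -- The Schwarz lemma is applied a second time, now to the difference quotient: each division by
  -- `t` gains one order of vanishing at `0`.
  have hb' := Complex.norm_dslope_le_div_of_mapsTo_ball hd hmaps' ht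
  have e1 := sub_smul_dslope g 0 t
  have e2 := sub_smul_dslope (dslope g 0) 0 t
  rw [dslope_same] at e2
  simp only [sub_zero, smul_eq_mul] at e1 e2
  constructor
  · rw [← e1, ← mul_sub, ← e2, norm_mul, norm_mul]
    nlinarith [sq_nonneg ‖t‖]
  · have := hb 0 h0
    rw [dslope_same] at this
    linarith

/-- A function which is holomorphic near a point has, locally uniformly, a quadratic Taylor
remainder. -/
lemma exists_taylor_bound {E : Type*} [NormedAddCommGroup E] [NormedSpace ℂ E] {F : E → ℂ}
    {U : Set E} (hU : IsOpen U) {ζ : E} (hζ : ζ ∈ U) (hF : DifferentiableOn ℂ F U) :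
    ∃ r > 0, ∃ C : ℝ, ball ζ (3 * r) ⊆ U ∧ (∀ z ∈ ball ζ (3 * r), ‖F z‖ ≤ C) ∧
      ∀ z ∈ ball ζ r, ‖fderiv ℂ F z‖ ≤ C ∧
        ∀ h : E, ‖h‖ < r → ‖F (z + h) - F z - fderiv ℂ F z h‖ ≤ C * ‖h‖ ^ 2 := by
  have hc : ContinuousAt F ζ := (hF.differentiableAt (hU.mem_nhds hζ)).continuousAt
  have hbd : ∀ᶠ z in 𝓝 ζ, ‖F z‖ < ‖F ζ‖ + 1 :=
    hc.norm.eventually_lt continuousAt_const (by simp)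
  obtain ⟨ρ, hρ, hsub⟩ := Metric.mem_nhds_iff.1 (inter_mem (hU.mem_nhds hζ) hbd)
  set M := ‖F ζ‖ + 1
  have hM0 : 0 ≤ M := by positivity
  -- A centre within `r` of `ζ`, moved by `s • u` with `‖s‖ < 2` and `‖u‖ = r`, stays within `3 *
  -- r`.
  obtain ⟨r, hr, hr3⟩ : ∃ r > 0, 3 * r = ρ := ⟨ρ / 3, by positivity, by ring⟩
  have hsub' : ball ζ (3 * r) ⊆ U := fun z hz => (hsub (hr3 ▸ hz)).1
  have hFM : ∀ z ∈ ball ζ (3 * r), ‖F z‖ ≤ M := fun z hz => (hsub (hr3 ▸ hz)).2.le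
  have key : ∀ z ∈ ball ζ r, ∀ u : E, ‖u‖ = r → ∀ t ∈ ball (0 : ℂ) 2,
      ‖F (z + t • u) - F z - t * fderiv ℂ F z u‖ ≤ M * ‖t‖ ^ 2 ∧
        ‖fderiv ℂ F z u‖ ≤ M := by
    intro z hz u hu t ht
    have hmem : ∀ s ∈ ball (0 : ℂ) 2, z + s • u ∈ ball ζ (3 * r) := fun s hs => by
      rw [mem_ball_iff_norm] at hz ⊢
      rw [mem_ball_zero_iff] at hs
      have h1 : ‖z + s • u - ζ‖ ≤ ‖z - ζ‖ + ‖s‖ * ‖u‖ := by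
        rw [add_sub_right_comm, ← norm_smul]
        exact norm_add_le _ _
      rw [hu] at h1
      nlinarith
    have hl : ∀ s : ℂ, HasDerivAt (fun s : ℂ => z + s • u) u s := fun s => by
      simpa using ((hasDerivAt_id s).smul_const u).const_add z
    have hFd : ∀ s ∈ ball (0 : ℂ) 2, HasDerivAt (fun s : ℂ => F (z + s • u))
        (fderiv ℂ F (z + s • u) u) s := fun s hs =>
      ((hF.differentiableAt (hU.mem_nhds (hsub' (hmem s hs)))).hasFDerivAt).comp_hasDerivAt s
        (hl s)
    have h0 := (hFd 0 (by simp)).deriv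
    have := norm_sub_sub_mul_deriv_le (g := fun s : ℂ => F (z + s • u)) (M := M)
      (fun s hs => (hFd s hs).differentiableAt.differentiableWithinAt)
      (fun s hs => hFM _ (hmem s hs)) ht
    rw [h0] at this
    simpa using this
  have hunit : ∀ h : E, h ≠ 0 → ‖((r / ‖h‖ : ℝ) : ℂ) • h‖ = r := fun h hh => by
    rw [norm_smul, Complex.norm_real, Real.norm_of_nonneg (by positivity),
      div_mul_cancel₀ _ (norm_ne_zero_iff.2 hh)]
  -- Rescaling from directions of norm `r` costs `1 / r` in the derivative and `1 / r ^ 2` in the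
  -- remainder.
  refine ⟨r, hr, max M (max (M / r) (M / r ^ 2)), hsub',
    fun z hz => (hFM z hz).trans (le_max_left _ _), fun z hz => ⟨?_, fun h hh => ?_⟩⟩
  · refine le_trans ?_ ((le_max_left _ _).trans (le_max_right _ _))
    refine ContinuousLinearMap.opNorm_le_bound _ (by positivity) fun h => ?_
    rcases eq_or_ne h 0 with rfl | h0
    · simp
    have hp : 0 < ‖h‖ := norm_pos_iff.2 h0
    have := (key z hz _ (hunit h h0) 0 (by simp)).2
    rw [map_smul, norm_smul, Complex.norm_real, Real.norm_of_nonneg (by positivity),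
      div_mul_eq_mul_div, div_le_iff₀ hp] at this
    rw [div_mul_eq_mul_div, le_div_iff₀ hr]
    linarith
  · refine le_trans ?_ (mul_le_mul_of_nonneg_right
      ((le_max_right _ _).trans (le_max_right _ _)) (sq_nonneg _))
    rcases eq_or_ne h 0 with rfl | h0
    · simp
    have hp : 0 < ‖h‖ := norm_pos_iff.2 h0
    have hnt : ‖((‖h‖ / r : ℝ) : ℂ)‖ = ‖h‖ / r := by
      rw [Complex.norm_real, Real.norm_of_nonneg (by positivity)]
    have := (key z hz _ (hunit h h0) ((‖h‖ / r : ℝ) : ℂ) (by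
      rw [mem_ball_zero_iff, hnt, div_lt_iff₀ hr]; linarith)).1
    have hth : ((‖h‖ / r : ℝ) : ℂ) • ((r / ‖h‖ : ℝ) : ℂ) • h = h := by
      rw [smul_smul, ← Complex.ofReal_mul, div_mul_div_comm, mul_comm r, div_self (by positivity)]
      simp
    rw [← smul_eq_mul (a := ((‖h‖ / r : ℝ) : ℂ)), ← map_smul, hth, hnt] at this
    rwa [div_pow, ← mul_div_assoc, ← div_mul_eq_mul_div] at this

/-! ### Generic non-extendability on compact sets without isolated points -/

section Extendable

variable {n : ℕ} {L : Set (EuclideanSpace ℂ (Fin n))}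

/-- The functions in `C(L)` which agree near `ζ` with a function bounded by `C` that has a
first-order Taylor expansion on the ball of radius `r`, with quantitative bounds. -/
def taylorExtendable (L : Set (EuclideanSpace ℂ (Fin n))) (ζ : EuclideanSpace ℂ (Fin n))
    (r C : ℝ) : Set C(L, ℂ) :=
  {f | ∃ (F : EuclideanSpace ℂ (Fin n) → closedBall (0 : ℂ) C)
      (A : EuclideanSpace ℂ (Fin n) → closedBall (0 : EuclideanSpace ℂ (Fin n) →L[ℂ] ℂ) C),
    (∀ z : L, (z : EuclideanSpace ℂ (Fin n)) ∈ ball ζ r → (F z : ℂ) = f z) ∧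
      ∀ z ∈ ball ζ r, ∀ h : EuclideanSpace ℂ (Fin n), ‖h‖ < r →
        ‖(F (z + h) : ℂ) - F z - (A z : EuclideanSpace ℂ (Fin n) →L[ℂ] ℂ) h‖ ≤ C * ‖h‖ ^ 2}

/-- Tychonoff stands in for Montel: `F` and `A` are arbitrary functions under pointwise convergence,
and projection along a compact factor is closed. -/
lemma isClosed_taylorExtendable (ζ : EuclideanSpace ℂ (Fin n)) (r C : ℝ) :
    IsClosed (taylorExtendable L ζ r C) := by
  have : ProperSpace (EuclideanSpace ℂ (Fin n) →L[ℂ] ℂ) := FiniteDimensional.proper ℂ _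
  let K := (EuclideanSpace ℂ (Fin n) → closedBall (0 : ℂ) C) ×
    (EuclideanSpace ℂ (Fin n) → closedBall (0 : EuclideanSpace ℂ (Fin n) →L[ℂ] ℂ) C)
  let S : Set (C(L, ℂ) × K) :=
    {p | ∀ z : L, (z : EuclideanSpace ℂ (Fin n)) ∈ ball ζ r → (p.2.1 z : ℂ) = p.1 z} ∩
    {p | ∀ z ∈ ball ζ r, ∀ h : EuclideanSpace ℂ (Fin n), ‖h‖ < r →
        ‖(p.2.1 (z + h) : ℂ) - p.2.1 z - (p.2.2 z : EuclideanSpace ℂ (Fin n) →L[ℂ] ℂ) h‖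
          ≤ C * ‖h‖ ^ 2}
  have hF : ∀ z, Continuous fun p : C(L, ℂ) × K => (p.2.1 z : ℂ) := fun z =>
    continuous_subtype_val.comp ((continuous_apply z).comp (continuous_fst.comp continuous_snd))
  have hA : ∀ z, Continuous fun p : C(L, ℂ) × K =>
      (p.2.2 z : EuclideanSpace ℂ (Fin n) →L[ℂ] ℂ) := fun z =>
    continuous_subtype_val.comp ((continuous_apply z).comp (continuous_snd.comp continuous_snd))
  have hS : IsClosed S := by
    refine IsClosed.inter ?_ ?_
    · simp only [Set.ofPred_forall]
      refine isClosed_iInter fun z => isClosed_iInter fun _ => isClosed_eq (hF z) ?_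
      exact (continuous_eval_const z).comp continuous_fst
    · simp only [Set.ofPred_forall]
      refine isClosed_iInter fun z => isClosed_iInter fun _ => isClosed_iInter fun h =>
        isClosed_iInter fun _ => isClosed_le ?_ continuous_const
      exact (((hF _).sub (hF _)).sub ((hA z).clm_apply continuous_const)).norm
  have := isClosedMap_fst_of_compactSpace (X := C(L, ℂ)) (Y := K) S hS
  convert this using 1
  ext f
  constructor
  · rintro ⟨F, A, h⟩
    exact ⟨(f, F, A), h, rfl⟩
  · rintro ⟨⟨g, F, A⟩, h, rfl⟩
    exact ⟨F, A, h⟩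

/-- The quadratic remainder is `o(‖h‖)`, so it alone forces `F` to be differentiable with derivative
`A`. -/
lemma HolomorphicallyExtendableAt.of_taylorExtendable {f : C(L, ℂ)} {ζ : L} {r C : ℝ}
    (hr : 0 < r) (hf : f ∈ taylorExtendable L (ζ : EuclideanSpace ℂ (Fin n)) r C) :
    HolomorphicallyExtendableAt f ζ := by
  obtain ⟨F, A, hFf, hT⟩ := hf
  refine ⟨ball ζ r, isOpen_ball, mem_ball_self hr, fun z => F z, fun z hz => ?_, hFf⟩
  have : HasFDerivAt (fun z => (F z : ℂ)) (A z : EuclideanSpace ℂ (Fin n) →L[ℂ] ℂ) z := by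
    rw [hasFDerivAt_iff_isLittleO_nhds_zero]
    have hO : (fun h => (F (z + h) : ℂ) - F z - (A z : EuclideanSpace ℂ (Fin n) →L[ℂ] ℂ) h)
        =O[𝓝 0] fun h => ‖h‖ ^ 2 := by
      refine Asymptotics.IsBigO.of_bound C ?_
      filter_upwards [ball_mem_nhds 0 hr] with h hh
      simpa using hT z hz h (by simpa using hh)
    exact hO.trans_isLittleO (Asymptotics.isLittleO_norm_pow_id one_lt_two)
  exact this.differentiableAt.differentiableWithinAt

lemma HolomorphicallyExtendableAt.exists_taylorExtendable {f : C(L, ℂ)} {ζ : L}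
    (hf : HolomorphicallyExtendableAt f ζ) :
    ∃ k m : ℕ, f ∈ taylorExtendable L (ζ : EuclideanSpace ℂ (Fin n)) (1 / ((k : ℝ) + 1)) m := by
  classical
  obtain ⟨U, hU, hζ, F, hF, hFf⟩ := hf
  obtain ⟨r, hr, C, hsub, hb, hT⟩ := exists_taylor_bound hU hζ hF
  obtain ⟨k, hk⟩ := exists_nat_one_div_lt hr
  obtain ⟨m, hm⟩ := exists_nat_ge C
  have hball : ball (ζ : EuclideanSpace ℂ (Fin n)) (1 / ((k : ℝ) + 1)) ⊆ ball ζ r :=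
    ball_subset_ball hk.le
  have hball' : ball (ζ : EuclideanSpace ℂ (Fin n)) r ⊆ ball ζ (3 * r) :=
    ball_subset_ball (by linarith)
  -- The value `0` off the balls only keeps the functions total and bounded; it is never tested.
  refine ⟨k, m, fun z => ⟨if z ∈ ball (ζ : EuclideanSpace ℂ (Fin n)) (3 * r) then F z else 0, ?_⟩,
    fun z => ⟨if z ∈ ball (ζ : EuclideanSpace ℂ (Fin n)) r then fderiv ℂ F z else 0, ?_⟩,
    fun z hz => ?_, fun z hz h hh => ?_⟩
  · rw [mem_closedBall_zero_iff]
    split_ifs with hz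
    · exact (hb z hz).trans hm
    · simp
  · rw [mem_closedBall_zero_iff]
    split_ifs with hz
    · exact (hT z hz).1.trans hm
    · simp
  · have hz' := hball' (hball hz)
    simp only [if_pos hz']
    exact hFf z (hsub hz')
  · have hz' := hball hz
    have hzh : z + h ∈ ball (ζ : EuclideanSpace ℂ (Fin n)) (3 * r) := by
      rw [mem_ball_iff_norm] at hz' ⊢
      rw [add_sub_right_comm]
      linarith [norm_add_le (z - ζ) h]
    simp only [if_pos hz', if_pos hzh, if_pos (hball' hz')]
    exact ((hT z hz').2 h (hh.trans hk)).trans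
      (mul_le_mul_of_nonneg_right hm (sq_nonneg _))

lemma isGδ_nonExtendableAt (ζ : L) : IsGδ (nonExtendableAt L ζ) := by
  have : nonExtendableAt L ζ =
      ⋂ p : ℕ × ℕ, (taylorExtendable L (ζ : EuclideanSpace ℂ (Fin n))
        (1 / ((p.1 : ℝ) + 1)) p.2)ᶜ := by
    ext f
    simp only [nonExtendableAt, Set.mem_ofPred_eq, Set.mem_iInter, Set.mem_compl_iff]
    constructor
    · exact fun h p hp => h (.of_taylorExtendable (by positivity) hp)
    · intro h hf
      obtain ⟨k, m, hkm⟩ := hf.exists_taylorExtendable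
      exact h (k, m) hkm
  rw [this]
  exact IsGδ.iInter_of_isOpen fun p => (isClosed_taylorExtendable _ _ _).isOpen_compl

/-- The functions extendable at `ζ` form a linear subspace of `C(L)`. -/
def extendableSubmodule (ζ : L) : Submodule ℂ C(L, ℂ) where
  carrier := {f | HolomorphicallyExtendableAt f ζ}
  zero_mem' := ⟨Set.univ, isOpen_univ, Set.mem_univ _, 0, differentiableOn_const 0, by simp⟩
  add_mem' := by
    rintro f g ⟨U, hU, hζU, F, hF, hFf⟩ ⟨V, hV, hζV, G, hG, hGg⟩
    exact ⟨U ∩ V, hU.inter hV, ⟨hζU, hζV⟩, F + G,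
      (hF.mono Set.inter_subset_left).add (hG.mono Set.inter_subset_right),
      fun z hz => by simp [hFf z hz.1, hGg z hz.2]⟩
  smul_mem' := by
    rintro c f ⟨U, hU, hζU, F, hF, hFf⟩
    exact ⟨U, hU, hζU, c • F, hF.const_smul c, fun z hz => by simp [hFf z hz]⟩

/-- The square root of the distance to a non-isolated point is not extendable at that point. -/
lemma exists_not_holomorphicallyExtendableAt (ζ : L)
    (hζ : AccPt (ζ : EuclideanSpace ℂ (Fin n)) (𝓟 L)) :
    ∃ f : C(L, ℂ), ¬ HolomorphicallyExtendableAt f ζ := by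
  refine ⟨⟨fun z => ((√(dist z ζ) : ℝ) : ℂ), by fun_prop⟩, ?_⟩
  rintro ⟨U, hU, hζU, F, hF, hFf⟩
  have hd := (hF.differentiableAt (hU.mem_nhds hζU)).hasFDerivAt.isBigO_sub
  obtain ⟨C, hC, hb⟩ := hd.exists_pos
  have hF0 : F ζ = 0 := by rw [hFf ζ hζU]; simp
  have hsmall : ∀ᶠ z in 𝓝 (ζ : EuclideanSpace ℂ (Fin n)),
      C ^ 2 * ‖z - (ζ : EuclideanSpace ℂ (Fin n))‖ < 1 := by
    have : Continuous fun z : EuclideanSpace ℂ (Fin n) =>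
        C ^ 2 * ‖z - (ζ : EuclideanSpace ℂ (Fin n))‖ := by fun_prop
    exact this.continuousAt.eventually_lt continuousAt_const (by simp)
  obtain ⟨z, ⟨hne, hzL⟩, hz1, hz2, hz3⟩ := ((accPt_iff_frequently.1 hζ).and_eventually
    (hb.bound.and (hsmall.and (hU.mem_nhds hζU)))).exists
  have hFz := hFf ⟨z, hzL⟩ hz3
  simp only [ContinuousMap.coe_mk] at hFz
  rw [hF0, sub_zero, hFz, Complex.norm_real, Real.norm_of_nonneg (Real.sqrt_nonneg _),
    Subtype.dist_eq, dist_eq_norm] at hz1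
  have hp : 0 < ‖z - (ζ : EuclideanSpace ℂ (Fin n))‖ := norm_pos_iff.2 (sub_ne_zero.2 hne)
  have hsq : ‖z - (ζ : EuclideanSpace ℂ (Fin n))‖ ≤ (C * ‖z - (ζ : EuclideanSpace ℂ (Fin n))‖) ^ 2 := (Real.sqrt_le_left (by positivity)).1 hz1
  -- With `d = ‖z - ζ‖ > 0`, `d ≤ (C * d) ^ 2` gives `1 ≤ C ^ 2 * d`, against `hsmall`.
  nlinarith

lemma dense_nonExtendableAt (ζ : L) (hζ : AccPt (ζ : EuclideanSpace ℂ (Fin n)) (𝓟 L)) :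
    Dense (nonExtendableAt L ζ) := by
  obtain ⟨g, hg⟩ := exists_not_holomorphicallyExtendableAt ζ hζ
  have hne : extendableSubmodule ζ ≠ ⊤ := fun h =>
    hg (h ▸ Submodule.mem_top : g ∈ extendableSubmodule ζ)
  have : nonExtendableAt L ζ = (extendableSubmodule ζ : Set C(L, ℂ))ᶜ := rfl
  rw [this, ← interior_eq_empty_iff_dense_compl, Set.eq_empty_iff_forall_notMem]
  exact fun x hx => hne (Submodule.eq_top_of_nonempty_interior' _ ⟨x, hx⟩)

/-- Extendability is an open condition on the point: the same `U` and `F` serve at every point of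
`L` in `U`. -/
lemma nowhereExtendable_eq_biInter {D : Set L} (hD : Dense D) :
    nowhereExtendable L = ⋂ ζ ∈ D, nonExtendableAt L ζ := by
  ext f
  simp only [nowhereExtendable, nonExtendableAt, Set.mem_ofPred_eq, Set.mem_iInter]
  refine ⟨fun h ζ _ => h ζ, fun h ζ ⟨U, hU, hζ, hF⟩ => ?_⟩
  obtain ⟨ξ, hξU, hξD⟩ := hD.inter_open_nonempty _ (hU.preimage continuous_subtype_val) ⟨ζ, hζ⟩
  exact h ξ hξD ⟨U, hU, hξU, hF⟩

/-- On a compact set without isolated points, non-extendability is generic. -/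
theorem IsCompact.generic_nonExtendable (hL : IsCompact L)
    (hacc : ∀ ζ ∈ L, AccPt ζ (𝓟 L)) :
    (∀ ζ : L, IsGδ (nonExtendableAt L ζ) ∧ Dense (nonExtendableAt L ζ)) ∧
      IsGδ (nowhereExtendable L) ∧ Dense (nowhereExtendable L) := by
  have : CompactSpace L := isCompact_iff_compactSpace.1 hL
  obtain ⟨D, hDc, hD⟩ := TopologicalSpace.exists_countable_dense L
  have hdense : ∀ ζ : L, Dense (nonExtendableAt L ζ) :=
    fun ζ => dense_nonExtendableAt ζ (hacc ζ ζ.2)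
  rw [nowhereExtendable_eq_biInter hD]
  exact ⟨fun ζ => ⟨isGδ_nonExtendableAt ζ, hdense ζ⟩,
    IsGδ.biInter hDc fun ζ _ => isGδ_nonExtendableAt ζ,
    dense_biInter_of_Gδ (fun ζ _ => isGδ_nonExtendableAt ζ) hDc fun ζ _ => hdense ζ⟩

end Extendable

/-! ### Frontiers of the polydisc and the ball -/

/-- The frontier of a circle-invariant neighbourhood of the origin has no isolated points. -/
lemma accPt_frontier_of_smul_mem {E : Type*} [NormedAddCommGroup E] [NormedSpace ℂ E] {s : Set E}
    (hs : ∀ c : Circle, ∀ z ∈ s, c • z ∈ s) (h0 : s ∈ 𝓝 (0 : E)) {ζ : E} (hζ : ζ ∈ frontier s) :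
    AccPt ζ (𝓟 (frontier s)) := by
  have hζ0 : ζ ≠ 0 := by
    rintro rfl
    exact hζ.2 (mem_interior_iff_mem_nhds.2 h0)
  have hpre : ∀ c : Circle, (c • · : E → E) ⁻¹' s = s := fun c => by
    ext z
    exact ⟨fun h => by simpa using hs c⁻¹ _ h, hs c z⟩
  have hfr : ∀ c : Circle, c • ζ ∈ frontier s := fun c => by
    have := (Homeomorph.smul (α := E) c).preimage_frontier s
    change (c • · : E → E) ⁻¹' frontier s = frontier ((c • · : E → E) ⁻¹' s) at this
    rw [hpre] at this
    rw [← this] at hζ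
    exact hζ
  have hcont : Tendsto (fun t : ℝ => Circle.exp t • ζ) (𝓝[>] 0) (𝓝 ζ) := by
    have : Continuous fun t : ℝ => Circle.exp t • ζ := by fun_prop
    simpa using (this.tendsto 0).mono_left nhdsWithin_le_nhds
  rw [accPt_iff_frequently]
  refine hcont.frequently (Eventually.frequently ?_)
  -- For `0 < t < π` the rotation is nontrivial, so it moves `ζ ≠ 0`.
  filter_upwards [Ioo_mem_nhdsGT Real.pi_pos] with t ht
  refine ⟨fun h => ?_, hfr _⟩
  have h1 : (Circle.exp t : ℂ) = 1 := by
    have h2 : (Circle.exp t : ℂ) • ζ = (1 : ℂ) • ζ := by rw [one_smul]; exact h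
    exact smul_left_injective ℂ hζ0 h2
  rw [Circle.coe_exp, Complex.exp_eq_one_iff] at h1
  obtain ⟨k, hk⟩ := h1
  have hk' : t = k * (2 * Real.pi) := by
    have := congrArg Complex.im hk
    simpa using this
  have hk0 : 0 < (k : ℝ) := by
    by_contra! hle
    nlinarith [ht.1, Real.pi_pos]
  have hk1 : (1 : ℝ) ≤ k := by exact_mod_cast (by exact_mod_cast hk0 : 0 < k)
  nlinarith [ht.2, Real.pi_pos]

lemma unitPolydisc_isBounded (n : ℕ) : Bornology.IsBounded (unitPolydisc n) := by
  refine (isBounded_iff_forall_norm_le).2 ⟨√n, fun z hz => ?_⟩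
  rw [EuclideanSpace.norm_eq]
  refine Real.sqrt_le_sqrt ?_
  calc ∑ i, ‖z i‖ ^ 2 ≤ ∑ _i : Fin n, (1 : ℝ) :=
        Finset.sum_le_sum fun i _ => pow_le_one₀ (norm_nonneg _) (hz i).le
    _ = n := by simp

lemma unitPolydisc_mem_nhds_zero (n : ℕ) :
    unitPolydisc n ∈ 𝓝 (0 : EuclideanSpace ℂ (Fin n)) := by
  refine mem_of_superset (ball_mem_nhds 0 one_pos) fun z hz i => ?_
  exact (PiLp.norm_apply_le z i).trans_lt (by simpa using hz)

lemma isCompact_frontier_of_isBounded {E : Type*} [PseudoMetricSpace E] [ProperSpace E]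
    {s : Set E} (hs : Bornology.IsBounded s) : IsCompact (frontier s) :=
  hs.isCompact_closure.of_isClosed_subset isClosed_frontier frontier_subset_closure

theorem mainTheorem8 (n : ℕ) :
    ((∀ ζ : frontier (unitPolydisc n),
        IsGδ (nonExtendableAt (frontier (unitPolydisc n)) ζ) ∧
          Dense (nonExtendableAt (frontier (unitPolydisc n)) ζ)) ∧
      IsGδ (nowhereExtendable (frontier (unitPolydisc n))) ∧
        Dense (nowhereExtendable (frontier (unitPolydisc n)))) ∧
    ((∀ ζ : frontier (unitBall n),
        IsGδ (nonExtendableAt (frontier (unitBall n)) ζ) ∧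
          Dense (nonExtendableAt (frontier (unitBall n)) ζ)) ∧
      IsGδ (nowhereExtendable (frontier (unitBall n))) ∧
        Dense (nowhereExtendable (frontier (unitBall n)))) := by
  refine ⟨(isCompact_frontier_of_isBounded (unitPolydisc_isBounded n)).generic_nonExtendable
      fun ζ hζ => accPt_frontier_of_smul_mem (fun c z hz => ?_) (unitPolydisc_mem_nhds_zero n) hζ,
    (isCompact_frontier_of_isBounded isBounded_ball).generic_nonExtendable
      fun ζ hζ => accPt_frontier_of_smul_mem (fun c z hz => ?_) (ball_mem_nhds 0 one_pos) hζ⟩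
  · intro i
    change ‖(c : ℂ) * z i‖ < 1
    rw [norm_mul, Circle.norm_coe, one_mul]
    exact hz i
  · change (c : ℂ) • z ∈ ball 0 1
    rw [mem_ball_zero_iff, norm_smul, Circle.norm_coe, one_mul]
    exact mem_ball_zero_iff.1 hz
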